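/- Let $N\ge 0$ be an integer and let $q,t\in\mathbb{C}^{*}$. All operators below are $\mathbb{C}$-linear operators on the field $\mathbb{C}(x_1,\dots,x_N)$; let $\mathrm{Op}_N$ be the ring of these operators under composition. Rational functions act by multiplication, $\gamma_i=q^{-x_i\partial_{x_i}}$ is the substitution $x_i\mapsto q^{-1}x_i$, and $\sigma_{ij}$ exchanges $x_i$ and $x_j$. Let $\Lambda_N\subset\mathbb{C}[x_1,\dots,x_N]$ be the space of symmetric polynomials. For $i\neq j$ put $$A_{ij}=\frac{x_i-t\,x_j}{x_i-x_j},\qquad B_{ij}=\frac{(t-1)\,x_j}{x_i-x_j},$$ and for $1\le i\le N$ let $$Z_i=\prod_{k\ne i}A_{ik}\,\gamma_i+\sum_{j\neq i}B_{ij}\prod_{k\neq i,j}A_{jk}\;\gamma_j\,\sigma_{ij},\qquad U_i=(t-1)\prod_{k\neq i}A_{ik}\,\gamma_i .$$ Let $\omega$ and $u$ be formal central variables. For an operator $F=F(q,t)$ depending on $q$ and $t$ set $$\mathrm{P}\theta_\omega(uF)=\sum_{n\in\mathbb{Z}}\omega^{\frac{n^2-n}{2}}(-u)^n\,F(q^n,t^n),$$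 and let $$D_N(u)=\sum_{n_1,\dots,n_N\in\mathbb{Z}}\omega^{\sum_i\frac{n_i^2-n_i}{2}}(-u)^{\sum_i n_i}\prod_{i<j}\frac{t^{n_j}x_i-t^{n_i}x_j}{x_i-x_j}\;\prod_{i=1}^N\gamma_i^{n_i}.$$ These are elements of the ring $\mathrm{Op}_N((u))[[\omega]]$ of power series in $\omega$ whose coefficients are Laurent series in $u$ with finitely many negative powers. Theorem. The series $D_N(u)$ and $\mathrm{P}\theta_\omega(uZ_i)$, $1\le i\le N$, are invertible in $\mathrm{Op}_N((u))[[\omega]]$, and, as operators applied to elements of $\Lambda_N$ (that is, coefficient by coefficient in $\omega$ and $u$), $$D_N(ut)\,D_N(u)^{-1}=1+\sum_{i=1}^N\mathrm{P}\theta_\omega(uU_i)\,\mathrm{P}\theta_\omega(uZ_i)^{-1}\;\Big|_{\Lambda_N}.$$ -/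

import Mathlib

namespace Dell

noncomputable section

/-- The field `ℂ(x₁, …, x_N)` of rational functions. -/
abbrev RatFun (N : ℕ) : Type := FractionRing (MvPolynomial (Fin N) ℂ)

/-- The ring (under composition) of `ℂ`-linear operators on `ℂ(x₁, …, x_N)`. -/
abbrev Op (N : ℕ) : Type := Module.End ℂ (RatFun N)

/-- The ring `Op((u))[[ω]]`: power series in `ω` whose coefficients are Laurent series in `u`
(finitely many negative powers) with operator coefficients; `u` and `ω` are central. -/
abbrev OpSeries (N : ℕ) : Type := PowerSeries (LaurentSeries (Op N))

/-- The variable `x_i`, as an element of `ℂ(x₁, …, x_N)`. -/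
def x {N : ℕ} (i : Fin N) : RatFun N :=
  algebraMap (MvPolynomial (Fin N) ℂ) (RatFun N) (MvPolynomial.X i)

/-- The complex constant `c`, as an element of `ℂ(x₁, …, x_N)`. -/
abbrev const {N : ℕ} (c : ℂ) : RatFun N := algebraMap ℂ (RatFun N) c

/-- The operator of multiplication by a rational function. -/
def mulOp {N : ℕ} (a : RatFun N) : Op N := LinearMap.mulLeft ℂ a

/-- The substitution `x_i ↦ c x_i` (other variables fixed) on polynomials. -/
def scalePoly {N : ℕ} (i : Fin N) (c : ℂˣ) :
    MvPolynomial (Fin N) ℂ ≃ₐ[ℂ] MvPolynomial (Fin N) ℂ :=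
  AlgEquiv.ofAlgHom
    (MvPolynomial.aeval
      (Function.update MvPolynomial.X i (MvPolynomial.C (c : ℂ) * MvPolynomial.X i)))
    (MvPolynomial.aeval
      (Function.update MvPolynomial.X i (MvPolynomial.C ((c⁻¹ : ℂˣ) : ℂ) * MvPolynomial.X i)))
    (by
      ext1 j
      by_cases h : j = i
      · subst h
        simp [← mul_assoc, ← MvPolynomial.C_mul]
      · simp [Function.update_of_ne h])
    (by
      ext1 j
      by_cases h : j = i
      · subst h
        simp [← mul_assoc, ← MvPolynomial.C_mul]
      · simp [Function.update_of_ne h])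

/-- The shift operator `γ_i = q^{- x_i ∂_i}`, i.e. the automorphism of `ℂ(x₁, …, x_N)` over `ℂ`
with `x_i ↦ q⁻¹ x_i` and the other variables fixed. -/
def γ {N : ℕ} (i : Fin N) (q : ℂˣ) : RatFun N ≃ₐ[ℂ] RatFun N :=
  IsFractionRing.algEquivOfAlgEquiv (scalePoly i q⁻¹)

/-- The operator `σ_{ij}` exchanging the variables `x_i` and `x_j`. -/
def σ {N : ℕ} (i j : Fin N) : RatFun N ≃ₐ[ℂ] RatFun N :=
  IsFractionRing.algEquivOfAlgEquiv (MvPolynomial.renameEquiv ℂ (Equiv.swap i j))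

/-- An automorphism, regarded as an operator. -/
def autOp {N : ℕ} (e : RatFun N ≃ₐ[ℂ] RatFun N) : Op N := e.toLinearMap

/-- `A_{ij}(t) = (x_i - t x_j) / (x_i - x_j)`, used for `i ≠ j`. -/
def A {N : ℕ} (i j : Fin N) (t : ℂˣ) : RatFun N :=
  (x i - const (t : ℂ) * x j) / (x i - x j)

/-- `B_{ij}(t) = (t - 1) x_j / (x_i - x_j)`, used for `i ≠ j`. -/
def B {N : ℕ} (i j : Fin N) (t : ℂˣ) : RatFun N :=
  const ((t : ℂ) - 1) * x j / (x i - x j)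

/-- The covariant operator
`Z_i = ∏_{k ≠ i} A_{ik} γ_i + ∑_{j ≠ i} B_{ij} ∏_{k ≠ i, j} A_{jk} γ_j σ_{ij}`. -/
def Z {N : ℕ} (i : Fin N) (q t : ℂˣ) : Op N :=
  mulOp (∏ k ∈ Finset.univ.erase i, A i k t) * autOp (γ i q) +
    ∑ j ∈ Finset.univ.erase i,
      mulOp (B i j t * ∏ k ∈ (Finset.univ.erase i).erase j, A j k t) *
        autOp (γ j q) * autOp (σ i j)

/-- The auxiliary covariant operator `U_i = (t - 1) ∏_{k ≠ i} A_{ik} γ_i`. -/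
def U {N : ℕ} (i : Fin N) (q t : ℂˣ) : Op N :=
  mulOp (const ((t : ℂ) - 1) * ∏ k ∈ Finset.univ.erase i, A i k t) * autOp (γ i q)

/-- The finite set of all integers `n` with `(n² - n) / 2 = m`
(see `mem_thetaIndex`). -/
def thetaIndex (m : ℕ) : Finset ℤ :=
  (Finset.Icc (-(m : ℤ)) (m + 1)).filter fun n => n ^ 2 - n = 2 * (m : ℤ)

theorem mem_thetaIndex {m : ℕ} {n : ℤ} : n ∈ thetaIndex m ↔ n ^ 2 - n = 2 * (m : ℤ) := by
  simp only [thetaIndex, Finset.mem_filter, Finset.mem_Icc, and_iff_right_iff_imp]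
  intro h
  constructor <;> by_contra! hc <;> nlinarith

/-- The finite set of all `(n₁, …, n_N) ∈ ℤ^N` with `∑ (n_i² - n_i) / 2 = m`
(see `mem_dellIndex`). -/
def dellIndex (N m : ℕ) : Finset (Fin N → ℤ) :=
  (Fintype.piFinset fun _ => Finset.Icc (-(m : ℤ)) (m + 1)).filter
    fun n => ∑ i, (n i ^ 2 - n i) = 2 * (m : ℤ)

theorem mem_dellIndex {N m : ℕ} {n : Fin N → ℤ} :
    n ∈ dellIndex N m ↔ ∑ i, (n i ^ 2 - n i) = 2 * (m : ℤ) := by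
  simp only [dellIndex, Finset.mem_filter, Fintype.mem_piFinset, Finset.mem_Icc,
    and_iff_right_iff_imp]
  intro h i
  have h0 : ∀ a : ℤ, 0 ≤ a ^ 2 - a := by
    intro a
    rcases le_or_gt a 0 with ha | ha <;> nlinarith
  have h1 : n i ^ 2 - n i ≤ 2 * (m : ℤ) := by
    rw [← h]
    exact Finset.single_le_sum (f := fun i => n i ^ 2 - n i) (fun j _ => h0 (n j))
      (Finset.mem_univ i)
  constructor <;> by_contra! hc <;> nlinarith

/-- For an operator `F = F(q, t)` depending on `q` and `t`, the series
`Pθ_ω(u F)(q, t) = ∑_{n ∈ ℤ} ω^{(n² - n)/2} (-u)^n F(q^n, t^n)`. -/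
def Pθ {N : ℕ} (F : ℂˣ → ℂˣ → Op N) (q t : ℂˣ) : OpSeries N :=
  PowerSeries.mk fun m =>
    ∑ n ∈ thetaIndex m, HahnSeries.single n ((-1 : ℂ) ^ n • F (q ^ n) (t ^ n))

/-- The operator
`∏_{i < j} (t^{n_j} x_i - t^{n_i} x_j) / (x_i - x_j) ∏_i γ_i^{n_i}`. -/
def dellTerm {N : ℕ} (q t : ℂˣ) (n : Fin N → ℤ) : Op N :=
  mulOp (∏ i, ∏ j ∈ Finset.Ioi i,
      (const ((t : ℂ) ^ n j) * x i - const ((t : ℂ) ^ n i) * x j) / (x i - x j)) *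
    autOp (List.ofFn fun i => γ i q ^ n i).prod

/-- The generating function `D_N(c u)` for a constant `c ∈ ℂˣ`, where
`D_N(u) = ∑_{n₁, …, n_N ∈ ℤ} ω^{∑ (n_i² - n_i)/2} (-u)^{∑ n_i}
  ∏_{i < j} (t^{n_j} x_i - t^{n_i} x_j) / (x_i - x_j) ∏_i γ_i^{n_i}`. -/
def D (N : ℕ) (q t c : ℂˣ) : OpSeries N :=
  PowerSeries.mk fun m =>
    ∑ n ∈ dellIndex N m,
      HahnSeries.single (∑ i, n i) ((-(c : ℂ)) ^ (∑ i, n i) • dellTerm q t n)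

/-- Two operator series agree on `Λ_N`: for each `m` and `k`, their coefficients at `ω^m u^k`
take the same value on every symmetric polynomial. -/
def EqOnSymmetric {N : ℕ} (S T : OpSeries N) : Prop :=
  ∀ f ∈ MvPolynomial.symmetricSubalgebra (Fin N) ℂ, ∀ (m : ℕ) (k : ℤ),
    (PowerSeries.coeff m S).coeff k (algebraMap (MvPolynomial (Fin N) ℂ) (RatFun N) f) =
      (PowerSeries.coeff m T).coeff k (algebraMap (MvPolynomial (Fin N) ℂ) (RatFun N) f)

end

end Dell

/-!
Write `s_k = t^{n_k}` and `y_k = x_k / s_k`. Up to the factor `∏ s_k^{N-1}`, the rational function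
in the summand of `D_N(u)` at `n ∈ ℤ^N` is the quotient of Vandermonde products in `y` and in `x`.
So `D_N(u)` behaves as a determinant, and its cofactor at the variable `x_j` is the generating function
`H_j = D_{N-1}(ut)` in the remaining variables (`minorSeries`). Two facts about these cofactors
carry the proof.

* `Pθ(uZ_i) H_i = D_N(u)` on symmetric functions (`killsSymm_Pθ_Z_mul_minorSeries_sub`). The
  exchange `σ_{ij}` turns `H_i` into `H_j`, so on symmetric functions `Z_i` acts on the family
  `(H_j)_j` as a row of a matrix free of exchanges. Summand by summand in `n` the claim becomes
  `∑_j p(y_j) / ∏_{k ≠ j} (y_j - y_k) = 1` for `p(z) = ∏_{k ≠ i} (z - x_k)`, which is Lagrange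
  interpolation of a monic polynomial of degree `N - 1`. The nodes are distinct for all `q` and `t`,
  because the `x_k` are independent variables.
* `∑_i Pθ(uU_i) H_i = D_N(ut) - D_N(u)` (`sum_Pθ_U_mul_minorSeries`). Summand by summand this is
  Lagrange interpolation of `∏_k (z - x_k)` at the nodes `y_1, …, y_N` and `0`; the node `0`
  contributes `∏ s_k = t^{∑ n_k}`, the factor that distinguishes `D_N(ut)` from `D_N(u)`.

Both reductions to summands rest on `theta_mul_multiTheta`: a theta series in one variable times a
series over the `n` with `n_j = 0` is a series over all of `ℤ^N`.

The series that vanish on symmetric functions form a left ideal, which is also stable under right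
multiplication by series commuting with all `σ_{ij}`. As `D_N(u)` commutes with them, so does its
inverse, and `D_N(ut) D_N(u)⁻¹ - 1 - ∑_i Pθ(uU_i) Pθ(uZ_i)⁻¹`, which equals
`∑_i Pθ(uU_i) Pθ(uZ_i)⁻¹ (Pθ(uZ_i) H_i - D_N(u)) D_N(u)⁻¹`, lies in that ideal. Invertibility holds
because the `ω⁰`-coefficients of the series have the form `1 + O(u)`.
-/

namespace Dell

noncomputable section

/-! ### Theta series over a ring -/

section Series

variable {R : Type*} [Ring R] {N : ℕ}

/-- An element of the coefficient ring as a constant series in `u` and `ω`. -/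
def constSeries : R →+* PowerSeries (LaurentSeries R) :=
  (PowerSeries.C (R := LaurentSeries R)).comp (HahnSeries.C (Γ := ℤ) (R := R))

theorem coeff_constSeries_mul (a : R) (S : PowerSeries (LaurentSeries R)) (m : ℕ) (k : ℤ) :
    (PowerSeries.coeff m (constSeries a * S)).coeff k = a * (PowerSeries.coeff m S).coeff k := by
  simp [constSeries, PowerSeries.coeff_C_mul, HahnSeries.C_apply]

theorem coeff_mul_constSeries (a : R) (S : PowerSeries (LaurentSeries R)) (m : ℕ) (k : ℤ) :
    (PowerSeries.coeff m (S * constSeries a)).coeff k = (PowerSeries.coeff m S).coeff k * a := by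
  simp [constSeries, PowerSeries.coeff_mul_C, HahnSeries.C_apply, HahnSeries.coeff_mul_single_zero]

theorem series_ext {S T : PowerSeries (LaurentSeries R)}
    (h : ∀ m k, (PowerSeries.coeff m S).coeff k = (PowerSeries.coeff m T).coeff k) : S = T := by
  ext m : 1
  ext k
  exact h m k

/-- A Laurent series `1 + O(u)` over a possibly noncommutative ring is invertible. -/
theorem isUnit_laurentSeries {f : LaurentSeries R} (h0 : f.coeff 0 = 1)
    (hneg : ∀ k < 0, f.coeff k = 0) : IsUnit f := by
  have hf : f = HahnSeries.ofPowerSeries ℤ R (PowerSeries.mk fun n => f.coeff n) := by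
    ext k
    rcases lt_or_ge k 0 with hk | hk
    · rw [hneg k hk, HahnSeries.ofPowerSeries_apply, HahnSeries.embDomain_of_notMem_range]
      rintro ⟨n, hn⟩
      simp at hn
      omega
    · lift k to ℕ using hk
      rw [HahnSeries.ofPowerSeries_apply_coeff, PowerSeries.coeff_mk]
  rw [hf]
  refine IsUnit.map _ ?_
  have hc : PowerSeries.constantCoeff (PowerSeries.mk fun n : ℕ => f.coeff n) =
      ((1 : Rˣ) : R) := by
    rw [← PowerSeries.coeff_zero_eq_constantCoeff_apply, PowerSeries.coeff_mk]
    simpa using h0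
  exact ⟨⟨_, _, PowerSeries.mul_invOfUnit _ 1 hc, PowerSeries.invOfUnit_mul _ 1 hc⟩, rfl⟩

/-- A power series in `ω` whose constant coefficient is `1 + O(u)` is invertible. -/
theorem isUnit_series {S : PowerSeries (LaurentSeries R)}
    (h0 : (PowerSeries.coeff 0 S).coeff 0 = 1)
    (hneg : ∀ k < 0, (PowerSeries.coeff 0 S).coeff k = 0) : IsUnit S := by
  obtain ⟨u, hu⟩ := isUnit_laurentSeries h0 hneg
  have hc : PowerSeries.constantCoeff S = (u : LaurentSeries R) := by
    rw [hu, PowerSeries.coeff_zero_eq_constantCoeff_apply]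
  exact ⟨⟨_, _, PowerSeries.mul_invOfUnit _ u hc, PowerSeries.invOfUnit_mul _ u hc⟩, rfl⟩

variable [Algebra ℂ R]

/-- The series `∑_{n ∈ ℤ} ω^{(n² - n)/2} (-u)^n F(n)` with coefficients in an arbitrary
`ℂ`-algebra. -/
def theta (F : ℤ → R) : PowerSeries (LaurentSeries R) :=
  PowerSeries.mk fun m => ∑ n ∈ thetaIndex m, HahnSeries.single n ((-1 : ℂ) ^ n • F n)

/-- The series `∑_{n ∈ ℤ^N} ω^{∑ (n_i² - n_i)/2} (-u)^{∑ n_i} T(n)` with coefficients in an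
arbitrary `ℂ`-algebra. -/
def multiTheta (T : (Fin N → ℤ) → R) : PowerSeries (LaurentSeries R) :=
  PowerSeries.mk fun m =>
    ∑ n ∈ dellIndex N m, HahnSeries.single (∑ i, n i) ((-1 : ℂ) ^ (∑ i, n i) • T n)

theorem multiTheta_add (T T' : (Fin N → ℤ) → R) :
    multiTheta (fun n => T n + T' n) = multiTheta T + multiTheta T' := by
  ext m : 1
  simp [multiTheta, Finset.sum_add_distrib]

theorem multiTheta_zero : multiTheta (fun _ : Fin N → ℤ => (0 : R)) = 0 := by
  ext m : 1
  simp [multiTheta]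

theorem multiTheta_sum {ι : Type*} (s : Finset ι) (T : ι → (Fin N → ℤ) → R) :
    multiTheta (fun n => ∑ j ∈ s, T j n) = ∑ j ∈ s, multiTheta (T j) := by
  classical
  induction s using Finset.induction_on with
  | empty => simp [multiTheta_zero]
  | insert a s ha ih => simp [Finset.sum_insert ha, multiTheta_add, ih]

theorem multiTheta_sub (T T' : (Fin N → ℤ) → R) :
    multiTheta (fun n => T n - T' n) = multiTheta T - multiTheta T' := by
  rw [eq_sub_iff_add_eq, ← multiTheta_add]
  simp

theorem constSeries_mul_multiTheta (a : R) (T : (Fin N → ℤ) → R) :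
    constSeries a * multiTheta T = multiTheta fun n => a * T n := by
  refine series_ext fun m k => ?_
  rw [coeff_constSeries_mul]
  simp only [multiTheta, PowerSeries.coeff_mk, HahnSeries.coeff_sum, Finset.mul_sum]
  refine Finset.sum_congr rfl fun n _ => ?_
  by_cases h : k = ∑ i, n i <;> simp [h]

theorem multiTheta_mul_constSeries (a : R) (T : (Fin N → ℤ) → R) :
    multiTheta T * constSeries a = multiTheta fun n => T n * a := by
  refine series_ext fun m k => ?_
  rw [coeff_mul_constSeries]
  simp only [multiTheta, PowerSeries.coeff_mk, HahnSeries.coeff_sum, Finset.sum_mul]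
  refine Finset.sum_congr rfl fun n _ => ?_
  by_cases h : k = ∑ i, n i <;> simp [h]

theorem theta_mul_constSeries (a : R) (F : ℤ → R) :
    theta F * constSeries a = theta fun n => F n * a := by
  refine series_ext fun m k => ?_
  rw [coeff_mul_constSeries]
  simp only [theta, PowerSeries.coeff_mk, HahnSeries.coeff_sum, Finset.sum_mul]
  refine Finset.sum_congr rfl fun n _ => ?_
  by_cases h : k = n <;> simp [h]

theorem theta_add (F G : ℤ → R) : theta (fun n => F n + G n) = theta F + theta G := by
  ext m : 1
  simp [theta, Finset.sum_add_distrib]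

theorem theta_zero : theta (fun _ : ℤ => (0 : R)) = 0 := by
  ext m : 1
  simp [theta]

theorem theta_sum {ι : Type*} (s : Finset ι) (F : ι → ℤ → R) :
    theta (fun n => ∑ j ∈ s, F j n) = ∑ j ∈ s, theta (F j) := by
  classical
  induction s using Finset.induction_on with
  | empty => simp [theta_zero]
  | insert a s ha ih => simp [Finset.sum_insert ha, theta_add, ih]

theorem multiTheta_comp_perm (w : Equiv.Perm (Fin N)) (T : (Fin N → ℤ) → R) :
    multiTheta (fun n => T (n ∘ w)) = multiTheta T := by
  ext m : 1
  simp only [multiTheta, PowerSeries.coeff_mk]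
  refine Finset.sum_equiv (Equiv.arrowCongr w.symm (Equiv.refl ℤ)) (fun n => ?_) fun n _ => ?_
  · rw [mem_dellIndex, mem_dellIndex]
    simp only [Equiv.arrowCongr_apply, Equiv.symm_symm, Function.comp_apply, Equiv.refl_apply]
    rw [Equiv.sum_comp w fun i => n i ^ 2 - n i]
  · have h : ∑ i, (Equiv.arrowCongr w.symm (Equiv.refl ℤ) n) i = ∑ i, n i := by
      simp only [Equiv.arrowCongr_apply, Equiv.symm_symm, Function.comp_apply, Equiv.refl_apply]
      exact Equiv.sum_comp w n
    rw [h]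
    rfl

theorem single_mul_single_smul (a b : ℤ) (x y : R) :
    (HahnSeries.single a ((-1 : ℂ) ^ a • x) * HahnSeries.single b ((-1 : ℂ) ^ b • y) :
      LaurentSeries R) = HahnSeries.single (a + b) ((-1 : ℂ) ^ (a + b) • (x * y)) := by
  rw [HahnSeries.single_mul_single, smul_mul_smul_comm, zpow_add₀ (by norm_num)]

theorem sum_update_comp (g : ℤ → ℤ) (n : Fin N → ℤ) (j : Fin N) (p : ℤ) :
    ∑ i, g (Function.update n j p i) = g p + (∑ i, g (n i) - g (n j)) := by
  rw [← Finset.add_sum_erase _ _ (Finset.mem_univ j),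
    ← Finset.add_sum_erase _ (fun i => g (n i)) (Finset.mem_univ j)]
  simp only [Function.update_self, add_sub_cancel_left, add_right_inj]
  exact Finset.sum_congr rfl fun i hi => by
    rw [Function.update_of_ne (Finset.ne_of_mem_erase hi)]

theorem sq_sub_self_nonneg (a : ℤ) : 0 ≤ a ^ 2 - a := by
  rcases le_or_gt a 0 with ha | ha <;> nlinarith

/-- A one-variable theta series times a multivariate one that lives on `n_j = 0` is the
multivariate theta series in which the summation variable of the first factor fills the free
slot `j`. -/
theorem theta_mul_multiTheta (F : ℤ → R) (T : (Fin N → ℤ) → R) (j : Fin N)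
    (hT : ∀ n, n j ≠ 0 → T n = 0) :
    theta F * multiTheta T =
      multiTheta fun n => F (n j) * T (Function.update n j 0) := by
  ext m : 1
  rw [PowerSeries.coeff_mul]
  simp only [theta, multiTheta, PowerSeries.coeff_mk, Finset.sum_mul_sum,
    single_mul_single_smul]
  -- Only the `n` with `n_j = 0` contribute; with them `(p, n) ↦ update n j p` is a bijection.
  have hfil : ∀ (p : ℤ) (b : ℕ),
      ∑ n ∈ dellIndex N b, (HahnSeries.single (p + ∑ i, n i)
        ((-1 : ℂ) ^ (p + ∑ i, n i) • (F p * T n)) : LaurentSeries R) =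
      ∑ n ∈ (dellIndex N b).filter (fun n => n j = 0), HahnSeries.single (p + ∑ i, n i)
        ((-1 : ℂ) ^ (p + ∑ i, n i) • (F p * T n)) := by
    intro p b
    refine (Finset.sum_subset (Finset.filter_subset _ _) fun n hn hn' => ?_).symm
    have : n j ≠ 0 := fun h => hn' (Finset.mem_filter.2 ⟨hn, h⟩)
    simp [hT n this]
  simp only [hfil]
  rw [Finset.sum_congr rfl fun ab _ => (Finset.sum_product' (thetaIndex ab.1)
    ((dellIndex N ab.2).filter fun n => n j = 0) fun p n =>
      (HahnSeries.single (p + ∑ i, n i)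
        ((-1 : ℂ) ^ (p + ∑ i, n i) • (F p * T n)) : LaurentSeries R)).symm]
  rw [Finset.sum_sigma']
  have hev : ∀ a : ℤ, ∃ c : ℕ, a ^ 2 - a = 2 * (c : ℤ) := by
    intro a
    obtain ⟨c, hc⟩ : Even (a ^ 2 - a) := by
      rw [show a ^ 2 - a = (a - 1) * ((a - 1) + 1) by ring]
      exact Int.even_mul_succ_self _
    refine ⟨c.toNat, ?_⟩
    have := sq_sub_self_nonneg a
    omega
  refine Finset.sum_bij (fun z _ => Function.update z.2.2 j z.2.1) ?_ ?_ ?_ ?_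
  · rintro ⟨⟨a, b⟩, p, n⟩ h
    simp only [Finset.mem_sigma, Finset.mem_product,
      Finset.mem_filter, mem_thetaIndex, mem_dellIndex] at h ⊢
    obtain ⟨hab, hp, hn, hj⟩ := h
    have hab := Finset.HasAntidiagonal.mem_antidiagonal.1 hab
    rw [sum_update_comp (fun a => a ^ 2 - a), hj, hn, hp, ← hab]
    push_cast
    ring
  · rintro ⟨⟨a, b⟩, p, n⟩ h ⟨⟨a', b'⟩, p', n'⟩ h' he
    simp only [Finset.mem_sigma, Finset.mem_product,
      Finset.mem_filter, mem_thetaIndex, mem_dellIndex] at h h' he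
    obtain ⟨hab, hp, hn, hj⟩ := h
    have hab := Finset.HasAntidiagonal.mem_antidiagonal.1 hab
    obtain ⟨hab', hp', hn', hj'⟩ := h'
    have hab' := Finset.HasAntidiagonal.mem_antidiagonal.1 hab'
    have h1 : p = p' := by simpa using congrFun he j
    have h2 : n = n' := by
      funext i
      by_cases hi : i = j
      · subst hi; rw [hj, hj']
      · simpa [Function.update_of_ne hi] using congrFun he i
    subst h1 h2
    have h3 : a = a' := by omega
    have h4 : b = b' := by omega
    subst h3 h4
    rfl
  · intro n hn
    rw [mem_dellIndex] at hn
    obtain ⟨a, ha⟩ := hev (n j)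
    have hle : n j ^ 2 - n j ≤ 2 * (m : ℤ) := by
      rw [← hn]
      exact Finset.single_le_sum (f := fun i => n i ^ 2 - n i) (fun i _ => sq_sub_self_nonneg (n i))
        (Finset.mem_univ j)
    refine ⟨⟨(a, m - a), n j, Function.update n j 0⟩, ?_, by simp⟩
    simp only [Finset.mem_sigma, Finset.mem_product,
      Finset.mem_filter, mem_thetaIndex, mem_dellIndex]
    refine ⟨Finset.HasAntidiagonal.mem_antidiagonal.2 (by omega), ha, ?_, by simp⟩
    rw [sum_update_comp (fun a => a ^ 2 - a), hn, ha]
    have : a ≤ m := by omega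
    push_cast [this]
    ring
  · rintro ⟨⟨a, b⟩, p, n⟩ h
    simp only [Finset.mem_sigma, Finset.mem_product,
      Finset.mem_filter, mem_thetaIndex, mem_dellIndex] at h
    obtain ⟨hab, hp, hn, hj⟩ := h
    have hab := Finset.HasAntidiagonal.mem_antidiagonal.1 hab
    have h1 := sum_update_comp (fun a => a) n j p
    simp only [hj, sub_zero] at h1
    rw [h1]
    have h2 : Function.update n j 0 = n := by rw [← hj, Function.update_eq_self]
    simp [h2]

theorem isUnit_theta {F : ℤ → R} (h : F 0 = 1) : IsUnit (theta F) := by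
  have hidx : ∀ n ∈ thetaIndex 0, n = 0 ∨ n = 1 := by
    intro n hn
    rw [mem_thetaIndex] at hn
    have : n * (n - 1) = 0 := by push_cast at hn; linarith [sq n]
    rcases mul_eq_zero.1 this with h | h
    · exact Or.inl h
    · exact Or.inr (by omega)
  refine isUnit_series ?_ fun k hk => ?_
  · simp only [theta, PowerSeries.coeff_mk, HahnSeries.coeff_sum]
    rw [Finset.sum_eq_single 0]
    · simp [h]
    · intro n _ hn0
      rw [HahnSeries.coeff_single_of_ne hn0.symm]
    · intro hn
      exact absurd (mem_thetaIndex.2 (by simp)) hn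
  · simp only [theta, PowerSeries.coeff_mk, HahnSeries.coeff_sum]
    refine Finset.sum_eq_zero fun n hn => HahnSeries.coeff_single_of_ne ?_
    rcases hidx n hn with rfl | rfl <;> omega

theorem isUnit_multiTheta {T : (Fin N → ℤ) → R} (h : T 0 = 1) : IsUnit (multiTheta T) := by
  -- At `ω = 0` every exponent `n_i` is `0` or `1`.
  have hidx : ∀ n ∈ dellIndex N 0, ∀ i, 0 ≤ n i := by
    intro n hn i
    rw [mem_dellIndex] at hn
    have hi := (Finset.sum_eq_zero_iff_of_nonneg fun i _ => sq_sub_self_nonneg (n i)).1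
      (by simpa using hn) i (Finset.mem_univ i)
    nlinarith
  refine isUnit_series ?_ fun k hk => ?_
  · simp only [multiTheta, PowerSeries.coeff_mk, HahnSeries.coeff_sum]
    rw [Finset.sum_eq_single 0]
    · simp [h]
    · intro n hn hn0
      refine HahnSeries.coeff_single_of_ne fun h0 => hn0 ?_
      funext i
      exact (Finset.sum_eq_zero_iff_of_nonneg fun i _ => hidx n hn i).1 h0.symm i
        (Finset.mem_univ i)
    · intro hn
      exact absurd (mem_dellIndex.2 (by simp)) hn
  · simp only [multiTheta, PowerSeries.coeff_mk, HahnSeries.coeff_sum]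
    refine Finset.sum_eq_zero fun n hn => HahnSeries.coeff_single_of_ne ?_
    have := Finset.sum_nonneg fun i (_ : i ∈ Finset.univ) => hidx n hn i
    omega

end Series

/-! ### Products over pairs and two Lagrange interpolation identities -/

section PairProducts

variable {F : Type*} [Field F] {N : ℕ}

/-- The product of `f a b` over all pairs `a < b` in `S`. -/
def pairProd (S : Finset (Fin N)) (f : Fin N → Fin N → F) : F :=
  ∏ a ∈ S, ∏ b ∈ S, if a < b then f a b else 1

theorem pairProd_insert {f : Fin N → Fin N → F} (hf : ∀ a b, f a b = f b a)
    {S : Finset (Fin N)} {j : Fin N} (hj : j ∉ S) :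
    pairProd (insert j S) f = (∏ k ∈ S, f j k) * pairProd S f := by
  simp only [pairProd, Finset.prod_insert hj, lt_irrefl, if_false, one_mul,
    Finset.prod_mul_distrib]
  rw [← mul_assoc, ← Finset.prod_mul_distrib]
  congr 1
  refine Finset.prod_congr rfl fun k hk => ?_
  have hjk : j ≠ k := fun h => hj (h ▸ hk)
  rcases lt_or_gt_of_ne hjk with h | h
  · simp [h, not_lt_of_gt h]
  · simp [h, not_lt_of_gt h, hf k j]

theorem pairProd_univ {f : Fin N → Fin N → F} (hf : ∀ a b, f a b = f b a) (j : Fin N) :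
    pairProd Finset.univ f =
      (∏ k ∈ Finset.univ.erase j, f j k) * pairProd (Finset.univ.erase j) f := by
  rw [← pairProd_insert hf (Finset.notMem_erase j _), Finset.insert_erase (Finset.mem_univ j)]

theorem pairProd_map {f : Fin N → Fin N → F} (hf : ∀ a b, f a b = f b a)
    (S : Finset (Fin N)) (w : Equiv.Perm (Fin N)) :
    pairProd (S.map w.toEmbedding) f = pairProd S fun a b => f (w a) (w b) := by
  induction S using Finset.induction_on with
  | empty => simp [pairProd]
  | insert j S hj ih =>
    rw [Finset.map_insert, pairProd_insert hf (by simpa using hj),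
      pairProd_insert (fun a b => hf _ _) hj, ih, Finset.prod_map]
    rfl

theorem pairProd_congr {f g : Fin N → Fin N → F} {S : Finset (Fin N)}
    (h : ∀ a ∈ S, ∀ b ∈ S, f a b = g a b) : pairProd S f = pairProd S g :=
  Finset.prod_congr rfl fun a ha => Finset.prod_congr rfl fun b hb => by rw [h a ha b hb]

theorem prod_prod_Ioi_eq_pairProd (f : Fin N → Fin N → F) :
    ∏ i, ∏ j ∈ Finset.Ioi i, f i j = pairProd Finset.univ f := by
  refine Finset.prod_congr rfl fun i _ => ?_
  rw [← Finset.prod_filter]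
  refine Finset.prod_congr ?_ fun _ _ => rfl
  ext j
  simp

theorem map_pairProd {G : Type*} [FunLike G F F] [RingHomClass G F F] (e : G)
    (S : Finset (Fin N)) (f : Fin N → Fin N → F) :
    e (pairProd S f) = pairProd S fun a b => e (f a b) := by
  simp only [pairProd, map_prod, apply_ite e, map_one]

end PairProducts

section Lagrange

variable {F : Type*} [Field F]

theorem div_injective {κ : Type*} (x : κ → F) {s : κ → F} (hs : ∀ k, s k ≠ 0)
    (hy : ∀ a b, a ≠ b → s b * x a - s a * x b ≠ 0) :
    Function.Injective fun k => x k / s k := by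
  intro a b h
  by_contra hab
  refine hy a b hab ?_
  have := (div_eq_div_iff (hs a) (hs b)).1 h
  linear_combination this

variable {ι : Type*} [Fintype ι] [DecidableEq ι]

/-- The sum over `j` of `p(y_j) / ∏_{k ≠ j} (y_j - y_k)` is the leading coefficient of `p`; here
`p = ∏_{k ≠ i} (X - x_k)`. -/
theorem sum_prod_sub_div_eq_one (x y : ι → F) (hy : Function.Injective y) (i : ι) :
    ∑ j, (∏ k ∈ Finset.univ.erase i, (y j - x k)) / ∏ k ∈ Finset.univ.erase j, (y j - y k) =
      1 := by
  have hdeg : (Lagrange.nodal (Finset.univ.erase i) x).degree + 1 =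
      (((Finset.univ : Finset ι).card : ℕ) : WithBot ℕ) := by
    rw [Lagrange.degree_nodal, Finset.card_erase_of_mem (Finset.mem_univ i)]
    have : 0 < (Finset.univ : Finset ι).card := Finset.card_pos.2 ⟨i, Finset.mem_univ i⟩
    norm_cast
    omega
  have h := Lagrange.leadingCoeff_eq_sum (s := Finset.univ) (v := y) hy.injOn hdeg.symm
  rw [(Lagrange.nodal_monic).leadingCoeff] at h
  rw [h]
  simp only [Lagrange.eval_nodal]

/-- The same leading coefficient formula for `p = ∏_k (X - x_k)` and the nodes `y_j` together
with the extra node `0`. -/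
theorem sum_prod_sub_div_add_eq_one (x y : ι → F) (hy : Function.Injective y)
    (hy0 : ∀ j, y j ≠ 0) :
    ∑ j, (∏ k, (y j - x k)) / (y j * ∏ k ∈ Finset.univ.erase j, (y j - y k)) +
      ∏ k, (x k / y k) = 1 := by
  let v : Option ι → F := fun o => o.elim 0 y
  have hv : Function.Injective v := by
    rintro (_ | a) (_ | b) h
    · rfl
    · exact absurd h.symm (hy0 b)
    · exact absurd h (hy0 a)
    · exact congrArg some (hy h)
  have hdeg : (Lagrange.nodal Finset.univ x).degree + 1 =
      (((Finset.univ : Finset (Option ι)).card : ℕ) : WithBot ℕ) := by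
    rw [Lagrange.degree_nodal]
    simp
  have h := Lagrange.leadingCoeff_eq_sum (s := Finset.univ) (v := v) hv.injOn hdeg.symm
  rw [(Lagrange.nodal_monic).leadingCoeff] at h
  rw [h, Fintype.sum_option, add_comm]
  simp only [Lagrange.eval_nodal]
  congr 1
  · have he : (Finset.univ : Finset (Option ι)).erase none =
        Finset.univ.map Function.Embedding.some := by
      ext o
      cases o <;> simp
    rw [he, Finset.prod_map, ← Finset.prod_div_distrib]
    refine Finset.prod_congr rfl fun k _ => ?_
    simp [v, neg_div_neg_eq]
  · refine Finset.sum_congr rfl fun j _ => ?_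
    have he : (Finset.univ : Finset (Option ι)).erase (some j) =
        insert none ((Finset.univ.erase j).map Function.Embedding.some) := by
      ext o
      cases o <;> simp
    rw [he, Finset.prod_insert (by simp), Finset.prod_map]
    simp [v]

theorem prod_sub_mul_eq (x : ι → F) {s : ι → F} {j : ι} (hs : s j ≠ 0) (i : ι) :
    ∏ k ∈ Finset.univ.erase i, (x j - s j * x k) =
      s j ^ (Fintype.card ι - 1) * ∏ k ∈ Finset.univ.erase i, (x j / s j - x k) := by
  rw [← Finset.card_univ, ← Finset.card_erase_of_mem (Finset.mem_univ i), ← Finset.prod_const,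
    ← Finset.prod_mul_distrib]
  refine Finset.prod_congr rfl fun k _ => ?_
  field_simp

theorem prod_mul_sub_mul_eq (x : ι → F) {s : ι → F} (hs : ∀ k, s k ≠ 0) (j : ι) :
    ∏ k ∈ Finset.univ.erase j, (s k * x j - s j * x k) =
      s j ^ (Fintype.card ι - 1) * (∏ k ∈ Finset.univ.erase j, s k) *
        ∏ k ∈ Finset.univ.erase j, (x j / s j - x k / s k) := by
  rw [← Finset.card_univ, ← Finset.card_erase_of_mem (Finset.mem_univ j), ← Finset.prod_const,
    ← Finset.prod_mul_distrib, ← Finset.prod_mul_distrib]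
  refine Finset.prod_congr rfl fun k _ => ?_
  have := hs j
  have := hs k
  field_simp

/-- The interpolation identity behind `Pθ(uZ_i) H_i = D(u)`, in the nodes `y_j = x_j / s_j`. -/
theorem sum_interp_eq_one (x s : ι → F) (hs : ∀ k, s k ≠ 0)
    (hx : ∀ a b, a ≠ b → x a - x b ≠ 0) (hy : ∀ a b, a ≠ b → s b * x a - s a * x b ≠ 0) (i : ι) :
    ∑ j, (∏ k ∈ Finset.univ.erase i, (x j - s j * x k)) /
        (∏ k ∈ Finset.univ.erase j, (x j - x k)) * (∏ k ∈ Finset.univ.erase j, s k) /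
        ∏ k ∈ Finset.univ.erase j, ((s k * x j - s j * x k) / (x j - x k)) = 1 := by
  have hinj := div_injective x hs hy
  rw [← sum_prod_sub_div_eq_one x _ hinj i]
  refine Finset.sum_congr rfl fun j _ => ?_
  have h1 := prod_sub_mul_eq x (hs j) i
  have h2 := prod_mul_sub_mul_eq x hs j
  have h3 : ∏ k ∈ Finset.univ.erase j, (x j - x k) ≠ 0 :=
    Finset.prod_ne_zero_iff.2 fun k hk => hx j k (Finset.ne_of_mem_erase hk).symm
  have h4 : ∏ k ∈ Finset.univ.erase j, s k ≠ 0 := Finset.prod_ne_zero_iff.2 fun k _ => hs k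
  have h5 : s j ^ (Fintype.card ι - 1) ≠ 0 := pow_ne_zero _ (hs j)
  have h6 : ∏ k ∈ Finset.univ.erase j, (x j / s j - x k / s k) ≠ 0 :=
    Finset.prod_ne_zero_iff.2 fun k hk => sub_ne_zero.2 fun h =>
      (Finset.ne_of_mem_erase hk).symm (hinj h)
  rw [Finset.prod_div_distrib, h1, h2]
  field_simp

/-- The interpolation identity behind `∑_i Pθ(uU_i) H_i = D(ut) - D(u)`, in the nodes
`y_j = x_j / s_j` and `0`. -/
theorem sum_interp_eq_prod_sub_one (x s : ι → F) (hs : ∀ k, s k ≠ 0) (hx0 : ∀ k, x k ≠ 0)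
    (hx : ∀ a b, a ≠ b → x a - x b ≠ 0) (hy : ∀ a b, a ≠ b → s b * x a - s a * x b ≠ 0) :
    ∑ j, ((s j - 1) * ∏ k ∈ Finset.univ.erase j, ((x j - s j * x k) / (x j - x k))) *
        (∏ k ∈ Finset.univ.erase j, s k) /
        ∏ k ∈ Finset.univ.erase j, ((s k * x j - s j * x k) / (x j - x k)) =
      ∏ k, s k - 1 := by
  have hinj := div_injective x hs hy
  have hmain := sum_prod_sub_div_add_eq_one x _ hinj fun j => div_ne_zero (hx0 j) (hs j)
  have hprod : ∏ k, x k / (x k / s k) = ∏ k, s k :=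
    Finset.prod_congr rfl fun k _ => by
      have := hs k
      have := hx0 k
      field_simp
  rw [hprod] at hmain
  rw [eq_sub_of_add_eq' hmain, sub_sub_cancel_left, ← Finset.sum_neg_distrib]
  refine Finset.sum_congr rfl fun j _ => ?_
  have h1 := prod_sub_mul_eq x (hs j) j
  have h2 := prod_mul_sub_mul_eq x hs j
  have h3 : ∏ k ∈ Finset.univ.erase j, (x j - x k) ≠ 0 :=
    Finset.prod_ne_zero_iff.2 fun k hk => hx j k (Finset.ne_of_mem_erase hk).symm
  have h4 : ∏ k ∈ Finset.univ.erase j, s k ≠ 0 := Finset.prod_ne_zero_iff.2 fun k _ => hs k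
  have h5 : s j ^ (Fintype.card ι - 1) ≠ 0 := pow_ne_zero _ (hs j)
  have h6 : ∏ k ∈ Finset.univ.erase j, (x j / s j - x k / s k) ≠ 0 :=
    Finset.prod_ne_zero_iff.2 fun k hk => sub_ne_zero.2 fun h =>
      (Finset.ne_of_mem_erase hk).symm (hinj h)
  have h7 := hs j
  have h8 := hx0 j
  rw [Finset.prod_div_distrib, Finset.prod_div_distrib, h1, h2,
    ← Finset.mul_prod_erase Finset.univ (fun k => x j / s j - x k) (Finset.mem_univ j)]
  -- The factor `k = j` of the numerator, `x_j / s_j - x_j`, supplies the factor `s_j - 1`.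
  generalize (∏ k ∈ Finset.univ.erase j, (x j / s j - x k / s k)) = a at *
  generalize (∏ k ∈ Finset.univ.erase j, (x j / s j - x k)) = b at *
  generalize (∏ k ∈ Finset.univ.erase j, (x j - x k)) = c at *
  field_simp
  ring

end Lagrange

/-! ### Substitutions and multiplication operators on rational functions -/

section Operators

variable {N : ℕ}

theorem algEquiv_ext {e e' : RatFun N ≃ₐ[ℂ] RatFun N} (h : ∀ i, e (x i) = e' (x i)) : e = e' := by
  have h1 : (e : RatFun N →+* RatFun N) = (e' : RatFun N →+* RatFun N) := by
    refine IsLocalization.ringHom_ext (nonZeroDivisors (MvPolynomial (Fin N) ℂ)) ?_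
    refine MvPolynomial.ringHom_ext (fun c => ?_) fun i => h i
    have hc : algebraMap (MvPolynomial (Fin N) ℂ) (RatFun N) (MvPolynomial.C c) =
        algebraMap ℂ (RatFun N) c :=
      (IsScalarTower.algebraMap_apply ℂ (MvPolynomial (Fin N) ℂ) (RatFun N) c).symm
    simp [hc]
  exact AlgEquiv.ext fun g => RingHom.congr_fun h1 g

theorem scalePoly_X (i k : Fin N) (c : ℂˣ) :
    scalePoly i c (MvPolynomial.X k) =
      Function.update MvPolynomial.X i (MvPolynomial.C (c : ℂ) * MvPolynomial.X i) k :=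
  MvPolynomial.aeval_X _ k

theorem γ_x (i k : Fin N) (q : ℂˣ) :
    γ i q (x k) = if k = i then const ((q⁻¹ : ℂˣ) : ℂ) * x k else x k := by
  rw [x, γ, IsFractionRing.algEquivOfAlgEquiv_algebraMap, scalePoly_X]
  by_cases h : k = i
  · subst h
    rw [Function.update_self, map_mul, if_pos rfl]
    rfl
  · rw [Function.update_of_ne h, if_neg h]

theorem σ_x (i j k : Fin N) : σ i j (x k) = x (Equiv.swap i j k) := by
  rw [x, σ, IsFractionRing.algEquivOfAlgEquiv_algebraMap]
  simp [x]

theorem σ_self (i : Fin N) : (σ i i : RatFun N ≃ₐ[ℂ] RatFun N) = 1 :=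
  algEquiv_ext fun k => by simp [σ_x]

theorem γ_zpow (i : Fin N) (q : ℂˣ) (m : ℤ) : γ i q ^ m = γ i (q ^ m) := by
  have hmul : ∀ a b : ℂˣ, (γ i (a * b) : RatFun N ≃ₐ[ℂ] RatFun N) = γ i a * γ i b := by
    intro a b
    refine algEquiv_ext fun k => ?_
    rw [AlgEquiv.mul_apply, γ_x, γ_x]
    by_cases h : k = i
    · simp only [h, if_true, map_mul, AlgEquiv.commutes, γ_x, mul_inv, Units.val_mul]
      ring
    · simp [h, γ_x]
  exact (map_zpow (MonoidHom.mk' (γ i) hmul) q m).symm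

/-- The product `∏_i γ_i^{n_i}` of powers of the shifts. -/
def shift (q : ℂˣ) (n : Fin N → ℤ) : RatFun N ≃ₐ[ℂ] RatFun N :=
  (List.ofFn fun i => γ i q ^ n i).prod

theorem shift_x (q : ℂˣ) (n : Fin N → ℤ) (k : Fin N) :
    shift q n (x k) = const (((q ^ n k)⁻¹ : ℂˣ) : ℂ) * x k := by
  have key : ∀ l : List (Fin N), l.Nodup →
      (l.map fun i => γ i q ^ n i).prod (x k) =
        if k ∈ l then const (((q ^ n k)⁻¹ : ℂˣ) : ℂ) * x k else x k := by
    intro l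
    induction l with
    | nil => simp
    | cons a l ih =>
      intro hl
      rw [List.nodup_cons] at hl
      rw [List.map_cons, List.prod_cons, AlgEquiv.mul_apply, ih hl.2, γ_zpow]
      by_cases ha : k = a
      · subst ha
        simp [hl.1, γ_x]
      · by_cases hk : k ∈ l <;> simp [ha, hk, γ_x]
  rw [shift, List.ofFn_eq_map, key _ (List.nodup_finRange N), if_pos (List.mem_finRange k)]

theorem γ_mul_shift_update (q : ℂˣ) (n : Fin N → ℤ) (j : Fin N) :
    γ j (q ^ n j) * shift q (Function.update n j 0) = shift q n := by
  refine algEquiv_ext fun k => ?_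
  rw [AlgEquiv.mul_apply, shift_x, shift_x, map_mul, AlgEquiv.commutes, γ_x]
  by_cases h : k = j
  · subst h
    simp
  · simp [h]

theorem σ_mul_shift (q : ℂˣ) (n : Fin N → ℤ) (i j : Fin N) :
    σ i j * shift q n = shift q (n ∘ Equiv.swap i j) * σ i j := by
  refine algEquiv_ext fun k => ?_
  rw [AlgEquiv.mul_apply, AlgEquiv.mul_apply, shift_x, σ_x, shift_x, map_mul,
    AlgEquiv.commutes, σ_x]
  simp

theorem mulOp_mul (a b : RatFun N) : mulOp (a * b) = mulOp a * mulOp b :=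
  LinearMap.mulLeft_mul ℂ (RatFun N) a b

theorem mulOp_one : mulOp (1 : RatFun N) = 1 := LinearMap.mulLeft_one ℂ (RatFun N)

theorem mulOp_sum {ι : Type*} (s : Finset ι) (a : ι → RatFun N) :
    mulOp (∑ j ∈ s, a j) = ∑ j ∈ s, mulOp (a j) := by
  refine LinearMap.ext fun g => ?_
  simp [mulOp, Finset.sum_mul]

theorem mulOp_sub (a b : RatFun N) : mulOp (a - b) = mulOp a - mulOp b := by
  refine LinearMap.ext fun g => ?_
  simp [mulOp, sub_mul]

theorem mulOp_const (c : ℂ) (F : Op N) : mulOp (const c) * F = c • F := by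
  refine LinearMap.ext fun g => ?_
  simp [mulOp, Algebra.smul_def]

theorem autOp_mul (e e' : RatFun N ≃ₐ[ℂ] RatFun N) : autOp (e * e') = autOp e * autOp e' := rfl

theorem autOp_one : autOp (1 : RatFun N ≃ₐ[ℂ] RatFun N) = 1 := rfl

theorem autOp_mul_mulOp (e : RatFun N ≃ₐ[ℂ] RatFun N) (a : RatFun N) :
    autOp e * mulOp a = mulOp (e a) * autOp e := by
  refine LinearMap.ext fun g => ?_
  simp [mulOp, autOp]

theorem x_ne_zero (i : Fin N) : (x i : RatFun N) ≠ 0 := by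
  rw [x, Ne, FaithfulSMul.algebraMap_eq_zero_iff]
  exact MvPolynomial.X_ne_zero i

theorem const_mul_x_sub_ne_zero {c d : ℂ} (hc : c ≠ 0) {a b : Fin N} (hab : a ≠ b) :
    const c * x a - const d * x b ≠ (0 : RatFun N) := by
  have h : const c * x a - const d * x b = algebraMap (MvPolynomial (Fin N) ℂ) (RatFun N)
      (MvPolynomial.C c * MvPolynomial.X a - MvPolynomial.C d * MvPolynomial.X b) := by
    rw [map_sub, map_mul, map_mul]
    rfl
  rw [h, Ne, FaithfulSMul.algebraMap_eq_zero_iff]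
  intro h0
  have := congrArg (MvPolynomial.eval (Pi.single a (1 : ℂ))) h0
  simp [hab.symm, hc] at this

theorem x_sub_ne_zero {a b : Fin N} (hab : a ≠ b) : (x a : RatFun N) - x b ≠ 0 := by
  simpa [const] using const_mul_x_sub_ne_zero (c := 1) (d := 1) one_ne_zero hab

end Operators

/-! ### The summands of the generating functions -/

section Terms

variable {N : ℕ}

/-- The factor `(t^{n_b} x_a - t^{n_a} x_b) / (x_a - x_b)` of the summands of `D`. -/
def pairRatio (t : ℂˣ) (n : Fin N → ℤ) (a b : Fin N) : RatFun N :=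
  (const ((t : ℂ) ^ n b) * x a - const ((t : ℂ) ^ n a) * x b) / (x a - x b)

theorem pairRatio_comm (t : ℂˣ) (n : Fin N → ℤ) (a b : Fin N) :
    pairRatio t n a b = pairRatio t n b a := by
  rw [pairRatio, pairRatio, ← neg_div_neg_eq, neg_sub, neg_sub]

theorem pairRatio_ne_zero (t : ℂˣ) (n : Fin N → ℤ) {a b : Fin N} (h : a ≠ b) :
    pairRatio t n a b ≠ 0 :=
  div_ne_zero (const_mul_x_sub_ne_zero (zpow_ne_zero _ t.ne_zero) h) (x_sub_ne_zero h)

theorem dellTerm_eq (q t : ℂˣ) (n : Fin N → ℤ) :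
    dellTerm q t n = mulOp (pairProd Finset.univ (pairRatio t n)) * autOp (shift q n) := by
  rw [← prod_prod_Ioi_eq_pairProd]
  rfl

theorem dellTerm_zero (q t : ℂˣ) : dellTerm q t (0 : Fin N → ℤ) = 1 := by
  have h1 : shift q (0 : Fin N → ℤ) = 1 := algEquiv_ext fun k => by simp [shift_x]
  have h2 : ∏ i : Fin N, ∏ j ∈ Finset.Ioi i, pairRatio t 0 i j = 1 := by
    refine Finset.prod_eq_one fun i _ => Finset.prod_eq_one fun j hj => ?_
    have := x_sub_ne_zero (ne_of_lt (Finset.mem_Ioi.1 hj))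
    simp [pairRatio, this]
  rw [dellTerm_eq, ← prod_prod_Ioi_eq_pairProd, h1, h2, mulOp_one, autOp_one, one_mul]

theorem σ_pairProd (i j : Fin N) (t : ℂˣ) (n : Fin N → ℤ) (S : Finset (Fin N)) :
    σ i j (pairProd S (pairRatio t n)) =
      pairProd (S.map (Equiv.swap i j).toEmbedding) (pairRatio t (n ∘ Equiv.swap i j)) := by
  rw [map_pairProd, pairProd_map (pairRatio_comm t _)]
  refine pairProd_congr fun a _ b _ => ?_
  simp [pairRatio, σ_x]

theorem autOp_σ_mul_dellTerm (i j : Fin N) (q t : ℂˣ) (n : Fin N → ℤ) :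
    autOp (σ i j) * dellTerm q t n = dellTerm q t (n ∘ Equiv.swap i j) * autOp (σ i j) := by
  rw [dellTerm_eq, dellTerm_eq, ← mul_assoc, autOp_mul_mulOp, mul_assoc, mul_assoc, ← autOp_mul,
    ← autOp_mul, σ_mul_shift, σ_pairProd, Finset.map_univ_equiv]

/-- The scalar factor
`t^{∑_{k ≠ j} n_k} ∏_{a < b; a, b ≠ j} (t^{n_b} x_a - t^{n_a} x_b) / (x_a - x_b)`
of the summands of `D_{N-1}(ut)` in the variables other than `x_j`. -/
def minorCoeff (t : ℂˣ) (j : Fin N) (n : Fin N → ℤ) : RatFun N :=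
  (∏ k ∈ Finset.univ.erase j, const ((t : ℂ) ^ n k)) *
    pairProd (Finset.univ.erase j) (pairRatio t n)

/-- The summands of `D_{N-1}(ut)` in the variables other than `x_j`, indexed by those `n ∈ ℤ^N`
with `n_j = 0` (and extended by zero to all of `ℤ^N`). -/
def minorTerm (q t : ℂˣ) (j : Fin N) (n : Fin N → ℤ) : Op N :=
  if n j = 0 then mulOp (minorCoeff t j n) * autOp (shift q n) else 0

theorem minorCoeff_update (t : ℂˣ) (j : Fin N) (n : Fin N → ℤ) (m : ℤ) :
    minorCoeff t j (Function.update n j m) = minorCoeff t j n := by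
  unfold minorCoeff
  congr 1
  · exact Finset.prod_congr rfl fun k hk => by
      rw [Function.update_of_ne (Finset.ne_of_mem_erase hk)]
  · refine pairProd_congr fun a ha b hb => ?_
    simp [pairRatio, Function.update_of_ne (Finset.ne_of_mem_erase ha),
      Function.update_of_ne (Finset.ne_of_mem_erase hb)]

theorem γ_minorCoeff (c t : ℂˣ) (j : Fin N) (n : Fin N → ℤ) :
    γ j c (minorCoeff t j n) = minorCoeff t j n := by
  unfold minorCoeff
  rw [map_mul, map_prod, map_pairProd]
  congr 1
  · exact Finset.prod_congr rfl fun k _ => AlgEquiv.commutes _ _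
  · refine pairProd_congr fun a ha b hb => ?_
    simp [pairRatio, γ_x, Finset.ne_of_mem_erase ha, Finset.ne_of_mem_erase hb]

/-- The coefficient of a summand of `H_j` is free of `x_j`, so `γ_j` passes through it and fills
the free slot `j` of the shift. -/
theorem mulOp_mul_γ_mul_minorTerm (q t : ℂˣ) (j : Fin N) (n : Fin N → ℤ) (a : RatFun N) :
    mulOp a * autOp (γ j (q ^ n j)) * minorTerm q t j (Function.update n j 0) =
      mulOp (a * minorCoeff t j n) * autOp (shift q n) := by
  rw [minorTerm, if_pos (Function.update_self ..), minorCoeff_update, mul_assoc,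
    ← mul_assoc (autOp _), autOp_mul_mulOp, γ_minorCoeff, mul_assoc, ← autOp_mul,
    γ_mul_shift_update, ← mul_assoc, mulOp_mul]

theorem autOp_σ_mul_minorTerm (i j : Fin N) (q t : ℂˣ) (n : Fin N → ℤ) :
    autOp (σ i j) * minorTerm q t i n =
      minorTerm q t j (n ∘ Equiv.swap i j) * autOp (σ i j) := by
  have hmap : (Finset.univ.erase i).map (Equiv.swap i j).toEmbedding = Finset.univ.erase j := by
    rw [Finset.map_erase, Finset.map_univ_equiv]
    simp
  have hc : σ i j (minorCoeff t i n) = minorCoeff t j (n ∘ Equiv.swap i j) := by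
    unfold minorCoeff
    rw [map_mul, σ_pairProd, hmap, ← hmap, Finset.prod_map, map_prod]
    congr 1
    exact Finset.prod_congr rfl fun k _ => by simp
  unfold minorTerm
  simp only [Function.comp_apply, Equiv.swap_apply_right]
  split_ifs
  · rw [← mul_assoc, autOp_mul_mulOp, mul_assoc, mul_assoc, ← autOp_mul, ← autOp_mul,
      σ_mul_shift, hc]
  · simp

/-- The coefficient `∏_{k ≠ i} (x_j - t x_k) / ∏_{k ≠ j} (x_j - x_k)` of `γ_j σ_{ij}` in
`Z_i`. -/
def zCoeff (i j : Fin N) (t : ℂˣ) : RatFun N :=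
  (∏ k ∈ Finset.univ.erase i, (x j - const (t : ℂ) * x k)) /
    ∏ k ∈ Finset.univ.erase j, (x j - x k)

theorem Z_eq_sum (i : Fin N) (q t : ℂˣ) :
    Z i q t = ∑ j, mulOp (zCoeff i j t) * autOp (γ j q) * autOp (σ i j) := by
  rw [← Finset.add_sum_erase _ _ (Finset.mem_univ i), σ_self, autOp_one, mul_one, Z]
  congr 1
  · rw [zCoeff, ← Finset.prod_div_distrib]
    rfl
  · refine Finset.sum_congr rfl fun j hj => ?_
    have hji : j ≠ i := Finset.ne_of_mem_erase hj
    congr 3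
    rw [zCoeff, ← Finset.mul_prod_erase _ _ hj,
      ← Finset.mul_prod_erase _ (fun k => x j - x k)
        (Finset.mem_erase.2 ⟨hji.symm, Finset.mem_univ i⟩),
      Finset.erase_right_comm (a := j), mul_div_mul_comm, ← Finset.prod_div_distrib, B]
    have h1 := x_sub_ne_zero hji
    have h2 := x_sub_ne_zero hji.symm
    congr 1
    rw [div_eq_div_iff h2 h1, const, map_sub, map_one]
    ring

theorem minorCoeff_eq_div_mul (t : ℂˣ) (n : Fin N → ℤ) (j : Fin N) :
    minorCoeff t j n = (∏ k ∈ Finset.univ.erase j, const ((t : ℂ) ^ n k)) /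
      (∏ k ∈ Finset.univ.erase j, pairRatio t n j k) * pairProd Finset.univ (pairRatio t n) := by
  have h : ∏ k ∈ Finset.univ.erase j, pairRatio t n j k ≠ 0 :=
    Finset.prod_ne_zero_iff.2 fun k hk => pairRatio_ne_zero t n (Finset.ne_of_mem_erase hk).symm
  rw [minorCoeff, pairProd_univ (pairRatio_comm t n) j]
  field_simp

theorem const_zpow_ne_zero (t : ℂˣ) (m : ℤ) : const ((t : ℂ) ^ m) ≠ (0 : RatFun N) :=
  (map_ne_zero (algebraMap ℂ (RatFun N))).2 (zpow_ne_zero m t.ne_zero)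

/-- Summand by summand, `∑_j zCoeff_{ij} γ_j H_j = D(u)`. -/
theorem sum_zCoeff_mul_minorTerm (q t : ℂˣ) (i : Fin N) (n : Fin N → ℤ) :
    ∑ j, mulOp (zCoeff i j (t ^ n j)) * autOp (γ j (q ^ n j)) *
        minorTerm q t j (Function.update n j 0) = dellTerm q t n := by
  simp only [mulOp_mul_γ_mul_minorTerm]
  rw [← Finset.sum_mul, ← mulOp_sum, dellTerm_eq]
  congr 2
  have h := sum_interp_eq_one (F := RatFun N) x (fun k => const ((t : ℂ) ^ n k))
    (fun k => const_zpow_ne_zero t _) (fun a b hab => x_sub_ne_zero hab)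
    (fun a b hab => const_mul_x_sub_ne_zero (zpow_ne_zero _ t.ne_zero) hab) i
  calc _ = (∑ j, (∏ k ∈ Finset.univ.erase i, (x j - const ((t : ℂ) ^ n j) * x k)) /
        (∏ k ∈ Finset.univ.erase j, (x j - x k)) *
        (∏ k ∈ Finset.univ.erase j, const ((t : ℂ) ^ n k)) /
        ∏ k ∈ Finset.univ.erase j, pairRatio t n j k) *
          pairProd Finset.univ (pairRatio t n) := by
        rw [Finset.sum_mul]
        refine Finset.sum_congr rfl fun j _ => ?_
        rw [minorCoeff_eq_div_mul, zCoeff, Units.val_zpow_eq_zpow_val]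
        ring
    _ = _ := by
        simp only [pairRatio] at h ⊢
        rw [h, one_mul]

theorem zpow_sum_eq_prod {ι : Type*} (t : ℂˣ) (s : Finset ι) (n : ι → ℤ) :
    (t : ℂ) ^ (∑ i ∈ s, n i) = ∏ i ∈ s, (t : ℂ) ^ n i := by
  classical
  induction s using Finset.induction_on with
  | empty => simp
  | insert a s ha ih => rw [Finset.sum_insert ha, Finset.prod_insert ha, zpow_add₀ t.ne_zero, ih]

/-- Summand by summand, `∑_i Pθ(uU_i) H_i = D(ut) - D(u)`. -/
theorem sum_U_mul_minorTerm (q t : ℂˣ) (n : Fin N → ℤ) :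
    ∑ j, U j (q ^ n j) (t ^ n j) * minorTerm q t j (Function.update n j 0) =
      (t : ℂ) ^ (∑ i, n i) • dellTerm q t n - dellTerm q t n := by
  simp only [U, mulOp_mul_γ_mul_minorTerm]
  rw [← Finset.sum_mul, ← mulOp_sum, dellTerm_eq, ← mulOp_const, ← mul_assoc, ← mulOp_mul,
    ← sub_mul, ← mulOp_sub]
  congr 2
  have h := sum_interp_eq_prod_sub_one (F := RatFun N) x (fun k => const ((t : ℂ) ^ n k))
    (fun k => const_zpow_ne_zero t _) x_ne_zero (fun a b hab => x_sub_ne_zero hab)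
    (fun a b hab => const_mul_x_sub_ne_zero (zpow_ne_zero _ t.ne_zero) hab)
  have hp : const ((t : ℂ) ^ (∑ i, n i)) = ∏ k, (const ((t : ℂ) ^ n k) : RatFun N) := by
    rw [← map_prod, zpow_sum_eq_prod]
  calc _ = (∑ j, ((const ((t : ℂ) ^ n j) - 1) *
          ∏ k ∈ Finset.univ.erase j, ((x j - const ((t : ℂ) ^ n j) * x k) / (x j - x k))) *
        (∏ k ∈ Finset.univ.erase j, const ((t : ℂ) ^ n k)) /
        ∏ k ∈ Finset.univ.erase j, pairRatio t n j k) *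
          pairProd Finset.univ (pairRatio t n) := by
        rw [Finset.sum_mul]
        refine Finset.sum_congr rfl fun j _ => ?_
        simp only [minorCoeff_eq_div_mul, A, const, Units.val_zpow_eq_zpow_val, map_sub, map_one]
        ring
    _ = _ := by
        rw [hp]
        simp only [pairRatio] at h ⊢
        rw [h]
        ring

end Terms

/-! ### Operator series on symmetric rational functions -/

section Symmetric

variable {N : ℕ}

/-- A rational function is symmetric if it is fixed by all exchanges of two variables. -/
def IsSymm (g : RatFun N) : Prop := ∀ i j, σ i j g = g

/-- All coefficients of the operator series vanish on symmetric rational functions. -/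
def KillsSymm (S : OpSeries N) : Prop :=
  ∀ (m : ℕ) (k : ℤ) (g : RatFun N), IsSymm g → (PowerSeries.coeff m S).coeff k g = 0

theorem isSymm_algebraMap {f : MvPolynomial (Fin N) ℂ}
    (hf : f ∈ MvPolynomial.symmetricSubalgebra (Fin N) ℂ) :
    IsSymm (algebraMap (MvPolynomial (Fin N) ℂ) (RatFun N) f) := by
  intro i j
  rw [σ, IsFractionRing.algEquivOfAlgEquiv_algebraMap]
  congr 1
  exact (MvPolynomial.mem_symmetricSubalgebra f).1 hf (Equiv.swap i j)

theorem coeff_mul_apply_eq_zero (S T : OpSeries N) (m : ℕ) (k : ℤ) (g : RatFun N)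
    (h : ∀ (a b : ℕ) (i j : ℤ),
      (PowerSeries.coeff a S).coeff i ((PowerSeries.coeff b T).coeff j g) = 0) :
    (PowerSeries.coeff m (S * T)).coeff k g = 0 := by
  rw [PowerSeries.coeff_mul, HahnSeries.coeff_sum, LinearMap.sum_apply]
  refine Finset.sum_eq_zero fun ab _ => ?_
  rw [HahnSeries.coeff_mul, LinearMap.sum_apply]
  exact Finset.sum_eq_zero fun ij _ => h _ _ _ _

theorem KillsSymm.mul_left {T : OpSeries N} (hT : KillsSymm T) (S : OpSeries N) :
    KillsSymm (S * T) := fun m k g hg =>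
  coeff_mul_apply_eq_zero S T m k g fun _ b _ j => by rw [hT b j g hg, map_zero]

/-- Operator series that commute with the exchanges of variables preserve symmetric functions, so
they may be multiplied to the right of a series that kills these. -/
theorem KillsSymm.mul_right {S T : OpSeries N} (hS : KillsSymm S)
    (hT : ∀ i j, Commute (constSeries (autOp (σ i j))) T) : KillsSymm (S * T) := by
  refine fun m k g hg => coeff_mul_apply_eq_zero S T m k g fun a b c d => hS a c _ fun i j => ?_
  have h := congrArg (fun V : OpSeries N => (PowerSeries.coeff b V).coeff d g) (hT i j).eq
  simp only [coeff_constSeries_mul, coeff_mul_constSeries] at h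
  simpa [autOp, hg i j] using h

theorem KillsSymm.sum {ι : Type*} {s : Finset ι} {S : ι → OpSeries N}
    (h : ∀ i ∈ s, KillsSymm (S i)) : KillsSymm (∑ i ∈ s, S i) := by
  intro m k g hg
  rw [map_sum, HahnSeries.coeff_sum, LinearMap.sum_apply]
  exact Finset.sum_eq_zero fun i hi => h i hi m k g hg

theorem killsSymm_mul_σ_sub (S : OpSeries N) (i j : Fin N) :
    KillsSymm (S * constSeries (autOp (σ i j)) - S) := by
  intro m k g hg
  rw [map_sub, HahnSeries.coeff_sub, coeff_mul_constSeries]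
  simp [autOp, hg i j]

theorem eqOnSymmetric_of_killsSymm {S T : OpSeries N} (h : KillsSymm (S - T)) :
    EqOnSymmetric S T := by
  intro f hf m k
  have := h m k _ (isSymm_algebraMap hf)
  rw [map_sub, HahnSeries.coeff_sub] at this
  exact sub_eq_zero.1 this

end Symmetric

/-! ### Two identities in noncommutative rings -/

section Ring

variable {A ι : Type*} [Ring A]

theorem sum_mul_mul_sub_sum_mul {s : Finset ι} {c h : ι → A} {h₀ : A} (a : ι → A)
    (hc : ∀ j ∈ s, c j * h₀ = h j * c j) :
    (∑ j ∈ s, a j * c j) * h₀ - ∑ j ∈ s, a j * h j = ∑ j ∈ s, a j * (h j * c j - h j) := by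
  rw [Finset.sum_mul, ← Finset.sum_sub_distrib]
  refine Finset.sum_congr rfl fun j hj => ?_
  rw [mul_assoc, hc j hj, mul_sub]

/-- If `∑ u_i h_i = d' - d`, then the defect of `d' d⁻¹ = 1 + ∑ u_i z_i⁻¹` is a combination of the
defects of `z_i h_i = d`. -/
theorem mul_inverse_sub_one_add_sum {s : Finset ι} {d d' : A} (hd : IsUnit d) (u : ι → A)
    {z h : ι → A} (hz : ∀ i ∈ s, IsUnit (z i)) (hu : ∑ i ∈ s, u i * h i = d' - d) :
    d' * Ring.inverse d - (1 + ∑ i ∈ s, u i * Ring.inverse (z i)) =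
      (∑ i ∈ s, u i * Ring.inverse (z i) * (z i * h i - d)) * Ring.inverse d := by
  have h1 : ∀ i ∈ s, u i * Ring.inverse (z i) * (z i * h i - d) =
      u i * h i - u i * Ring.inverse (z i) * d := by
    intro i hi
    rw [mul_sub, mul_assoc _ _ (_ * _), ← mul_assoc (Ring.inverse _),
      Ring.inverse_mul_cancel _ (hz i hi), one_mul]
  rw [Finset.sum_congr rfl h1, Finset.sum_sub_distrib, hu, ← Finset.sum_mul, sub_mul, sub_mul,
    mul_assoc _ d, Ring.mul_inverse_cancel _ hd, mul_one]
  abel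

end Ring

/-! ### The minors of the generating function -/

section Main

variable {N : ℕ}

/-- The generating function `H_j = D_{N-1}(ut)` in the variables other than `x_j`. -/
def minorSeries (q t : ℂˣ) (j : Fin N) : OpSeries N := multiTheta (minorTerm q t j)

theorem D_eq (q t c : ℂˣ) :
    D N q t c = multiTheta fun n => (c : ℂ) ^ (∑ i, n i) • dellTerm q t n := by
  ext m : 1
  simp only [D, multiTheta, PowerSeries.coeff_mk]
  refine Finset.sum_congr rfl fun n _ => ?_
  rw [smul_smul, ← mul_zpow, neg_one_mul]

theorem D_one_eq (q t : ℂˣ) : D N q t 1 = multiTheta (dellTerm q t) := by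
  rw [D_eq]
  simp

theorem constSeries_σ_mul_minorSeries (q t : ℂˣ) (i j : Fin N) :
    constSeries (autOp (σ i j)) * minorSeries q t i =
      minorSeries q t j * constSeries (autOp (σ i j)) := by
  rw [minorSeries, minorSeries, constSeries_mul_multiTheta, multiTheta_mul_constSeries]
  simp only [autOp_σ_mul_minorTerm]
  exact multiTheta_comp_perm (Equiv.swap i j) fun n => minorTerm q t j n * autOp (σ i j)

theorem commute_σ_D (q t : ℂˣ) (i j : Fin N) :
    Commute (constSeries (autOp (σ i j))) (D N q t 1) := by
  rw [Commute, SemiconjBy, D_one_eq, constSeries_mul_multiTheta, multiTheta_mul_constSeries]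
  simp only [autOp_σ_mul_dellTerm]
  exact multiTheta_comp_perm (Equiv.swap i j) fun n => dellTerm q t n * autOp (σ i j)

theorem theta_mul_minorSeries (q t : ℂˣ) (j : Fin N) (F : ℤ → Op N) :
    theta F * minorSeries q t j =
      multiTheta fun n => F (n j) * minorTerm q t j (Function.update n j 0) :=
  theta_mul_multiTheta F _ j fun _ hn => if_neg hn

/-- On symmetric functions `Pθ(uZ_i)` sends `H_i` to `D(u)`. -/
theorem killsSymm_Pθ_Z_mul_minorSeries_sub (q t : ℂˣ) (i : Fin N) :
    KillsSymm (Pθ (Z i) q t * minorSeries q t i - D N q t 1) := by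
  let F : Fin N → ℤ → Op N := fun j m => mulOp (zCoeff i j (t ^ m)) * autOp (γ j (q ^ m))
  have hZ : Pθ (Z i) q t = ∑ j, theta (F j) * constSeries (autOp (σ i j)) := by
    simp only [theta_mul_constSeries, ← theta_sum]
    change theta (fun m => Z i (q ^ m) (t ^ m)) = _
    simp only [Z_eq_sum, F]
  have hD : D N q t 1 = ∑ j, theta (F j) * minorSeries q t j := by
    simp only [theta_mul_minorSeries, ← multiTheta_sum, F, sum_zCoeff_mul_minorTerm, D_one_eq]
  have h : Pθ (Z i) q t * minorSeries q t i - D N q t 1 =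
      ∑ j, theta (F j) *
        (minorSeries q t j * constSeries (autOp (σ i j)) - minorSeries q t j) := by
    rw [hZ, hD]
    exact sum_mul_mul_sub_sum_mul _ fun j _ => constSeries_σ_mul_minorSeries q t i j
  rw [h]
  exact KillsSymm.sum fun j _ => (killsSymm_mul_σ_sub _ i j).mul_left _

theorem sum_Pθ_U_mul_minorSeries (q t : ℂˣ) :
    ∑ i : Fin N, Pθ (U i) q t * minorSeries q t i = D N q t t - D N q t 1 := by
  have hU : ∀ i : Fin N, Pθ (U i) q t = theta fun m => U i (q ^ m) (t ^ m) := fun _ => rfl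
  simp only [hU, theta_mul_minorSeries, ← multiTheta_sum, sum_U_mul_minorTerm, multiTheta_sub,
    D_eq q t t, D_one_eq]

theorem isUnit_D (q t : ℂˣ) : IsUnit (D N q t 1) := by
  rw [D_one_eq]
  exact isUnit_multiTheta (dellTerm_zero q t)

theorem isUnit_Pθ_Z (q t : ℂˣ) (i : Fin N) : IsUnit (Pθ (Z i) q t) := by
  refine isUnit_theta (F := fun m => Z i (q ^ m) (t ^ m)) ?_
  have h1 : γ i (1 : ℂˣ) = 1 := algEquiv_ext fun k => by simp [γ_x]
  have h2 : ∏ k ∈ Finset.univ.erase i, A i k 1 = 1 := by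
    refine Finset.prod_eq_one fun k hk => ?_
    have := x_sub_ne_zero (Finset.ne_of_mem_erase hk).symm
    simp [A, this]
  have h3 : ∀ j, B i j 1 = 0 := fun j => by simp [B]
  have h4 : mulOp (0 : RatFun N) = 0 := LinearMap.mulLeft_zero_eq_zero ℂ (RatFun N)
  simp only [zpow_zero, Z, h1, h2, h3, zero_mul, h4, mulOp_one, autOp_one, one_mul,
    Finset.sum_const_zero, add_zero]

end Main

end

end Dell

theorem mainTheorem2 (N : ℕ) (q t : ℂˣ) :
    IsUnit (Dell.D N q t 1) ∧
    (∀ i : Fin N, IsUnit (Dell.Pθ (Dell.Z i) q t)) ∧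
    Dell.EqOnSymmetric
      (Dell.D N q t t * Ring.inverse (Dell.D N q t 1))
      (1 + ∑ i : Fin N, Dell.Pθ (Dell.U i) q t * Ring.inverse (Dell.Pθ (Dell.Z i) q t)) := by
  have hD := Dell.isUnit_D (N := N) q t
  have hZ := Dell.isUnit_Pθ_Z (N := N) q t
  refine ⟨hD, hZ, Dell.eqOnSymmetric_of_killsSymm ?_⟩
  have h : Dell.D N q t t * Ring.inverse (Dell.D N q t 1) -
      (1 + ∑ i : Fin N, Dell.Pθ (Dell.U i) q t * Ring.inverse (Dell.Pθ (Dell.Z i) q t)) =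
      (∑ i : Fin N, Dell.Pθ (Dell.U i) q t * Ring.inverse (Dell.Pθ (Dell.Z i) q t) *
        (Dell.Pθ (Dell.Z i) q t * Dell.minorSeries q t i - Dell.D N q t 1)) *
        Ring.inverse (Dell.D N q t 1) :=
    Dell.mul_inverse_sub_one_add_sum (A := Dell.OpSeries N) hD _ (fun i _ => hZ i)
      (Dell.sum_Pθ_U_mul_minorSeries q t)
  rw [h]
  refine Dell.KillsSymm.mul_right (Dell.KillsSymm.sum fun i _ =>
    (Dell.killsSymm_Pθ_Z_mul_minorSeries_sub q t i).mul_left _) fun i j => ?_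
  obtain ⟨u, hu⟩ := hD
  have hc := Dell.commute_σ_D (N := N) q t i j
  rw [← hu] at hc ⊢
  rw [Ring.inverse_unit]
  exact hc.units_inv_right
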